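/- Let $S^2$ be the oriented 2-sphere. For a branched covering map $f\colon S^2\to S^2$ let $C_f$ be its set of critical points and $P_f=\bigcup_{n\ge 1}f^{n}(C_f)$ its postcritical set. A *NET map* is an orientation-preserving branched covering map $f\colon S^2\to S^2$ all of whose critical points are simple (local degree $2$) and such that $\#P_f=4$. It is *Euclidean* if its canonical orbifold has signature $(2,2,2,2)$; that is, the smallest function $\nu\colon S^2\to\{1,2,\dots\}\cup\{\infty\}$ (with respect to divisibility) such that $\nu(y)\deg_y(f)$ divides $\nu(f(y))$ for all $y$ takes the value $2$ at exactly four points and the value $1$ elsewhere. For a lattice $\Lambda\subset\mathbb{R}^2$ put $\Gamma_\Lambda=\{x\mapsto 2\lambda\pm x : \lambda\in\Lambda\}$. A map $g\colon S^2\to S^2$ *lifts via* $\pi\colon\mathbb{R}^2\to S^2$ to $\Phi\colon\mathbb{R}^2\to\mathbb{R}^2$ if $g\circ\pi=\pi\circ\Phi$. Let $f$ be a NET map. Let $\Lambda_1,\Lambda_2\subset\mathbb{R}^2$ be lattices and, for $i=1,2$, let $\pi_i\colon\mathbb{R}^2\to S^2$ be the canonical quotient map $\mathbb{R}^2\to\mathbb{R}^2/\Gamma_{\Lambda_i}$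 followed by an orientation-preserving homeomorphism $\mathbb{R}^2/\Gamma_{\Lambda_i}\cong S^2$, such that $\pi_2(\Lambda_2)=P_f$, $\pi_1(\Lambda_1)$ is the set of points of $f^{-1}(P_f)$ which are not critical points of $f$, and $f\circ\pi_1=\pi_2$. Suppose that $f=h\circ g$, where $h\colon S^2\to S^2$ is a homeomorphism and $g$ is a Euclidean NET map which lifts via $\pi_1$ to an affine isomorphism $\Phi\colon\mathbb{R}^2\to\mathbb{R}^2$ with $\Phi(\Lambda_2)=\Lambda_1$. Let $\psi\colon S^2\to S^2$ be an orientation-preserving branched covering map which lifts via $\pi_2$ to an affine isomorphism $\Psi\colon\mathbb{R}^2\to\mathbb{R}^2$ with $\Psi(\Lambda_2)\subseteq\Lambda_2$. Then there is exactly one map $g'\colon S^2\to S^2$ which lifts via $\pi_1$ to $\Phi\circ\Psi$; this $g'$ is a Euclidean NET map, and $\psi\circ f=h\circ g'$. -/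

import Mathlib

open Filter Topology

namespace NETMap

/-- The oriented 2-sphere, realised as the Riemann sphere `ℂ ∪ {∞}`. The plane `ℝ²` is `ℂ`,
with its standard orientation. -/
abbrev Sphere : Type := OnePoint ℂ

/-- For every small `r > 0` the image under `u` of the positively oriented circle of radius `r`
about `z` is a loop of winding number `+1` about `w`: it has the form `t ↦ w + exp (L t)` with `L`
continuous and `L (2π) = L 0 + 2πi`. When `u` is a local homeomorphism at `z` with `u z = w`, this
says that `u` preserves orientation at `z`. -/
def WindsPositively (u : ℂ → Sphere) (z w : ℂ) : Prop :=
  ∀ᶠ r : ℝ in 𝓝[>] 0, ∃ L : ℝ → ℂ, Continuous L ∧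
    L (2 * Real.pi) = L 0 + 2 * Real.pi * Complex.I ∧
    ∀ t : ℝ, u (z + r * Complex.exp (t * Complex.I)) = ((w + Complex.exp (L t) : ℂ) : Sphere)

/-- `f` has local degree `k` at `x`: in suitable topological charts centred at `x` and at `f x`,
the map `f` is `z ↦ z ^ k` near `x`. -/
def HasLocalDegree (f : Sphere → Sphere) (x : Sphere) (k : ℕ) : Prop :=
  1 ≤ k ∧ ∃ φ χ : OpenPartialHomeomorph Sphere ℂ,
    x ∈ φ.source ∧ φ x = 0 ∧ f x ∈ χ.source ∧ χ (f x) = 0 ∧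
    ∀ᶠ y in 𝓝 x, f y ∈ χ.source ∧ χ (f y) = φ y ^ k

/-- `f` is a branched covering of the (compact) sphere: continuous and, at every point, a power map
in suitable topological charts. -/
def IsBranchedCovering (f : Sphere → Sphere) : Prop :=
  Continuous f ∧ ∀ x, ∃ k, HasLocalDegree f x k

/-- `f` preserves orientation at the points where it has local degree one. Only points `z ≠ ∞` with
`f z ≠ ∞` are tested: for a branched covering the remaining points are isolated, and preservation of
orientation at `z` is the same as preservation at all nearby points. -/
def PreservesOrientation (f : Sphere → Sphere) : Prop :=
  ∀ z w : ℂ, f (z : Sphere) = (w : Sphere) → HasLocalDegree f (z : Sphere) 1 →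
    WindsPositively (fun u : ℂ => f (u : Sphere)) z w

/-- Orientation-preserving branched covering maps of the sphere to itself. -/
def IsOrientedBranchedCovering (f : Sphere → Sphere) : Prop :=
  IsBranchedCovering f ∧ PreservesOrientation f

/-- The critical points: those of local degree at least two. -/
def criticalSet (f : Sphere → Sphere) : Set Sphere :=
  {x | ∃ k, 2 ≤ k ∧ HasLocalDegree f x k}

/-- The postcritical set `⋃_{n ≥ 1} f^n (critical points)`. -/
def postcriticalSet (f : Sphere → Sphere) : Set Sphere :=
  {x | ∃ n : ℕ, 1 ≤ n ∧ ∃ c ∈ criticalSet f, f^[n] c = x}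

/-- Nearly Euclidean Thurston maps: orientation-preserving branched coverings of the sphere whose
critical points are simple and which have exactly four postcritical points (so the degree is at
least two). -/
structure IsNETMap (f : Sphere → Sphere) : Prop where
  branched : IsOrientedBranchedCovering f
  simple : ∀ x k, HasLocalDegree f x k → k ≤ 2
  four : (postcriticalSet f).ncard = 4

/-- `ν` is a weight function compatible with `f`: `ν y * deg_y f` divides `ν (f y)` for all `y`.
Values lie in `{1, 2, …} ∪ {∞}`, ordered by divisibility, with `∞` encoded as `0 : ℕ`. -/
def IsCompatibleWeight (f : Sphere → Sphere) (ν : Sphere → ℕ) : Prop :=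
  ∀ y k, HasLocalDegree f y k → ν y * k ∣ ν (f y)

/-- `ν` is the weight function of the canonical orbifold of `f`: the smallest compatible weight
function, for divisibility. -/
def IsOrbifoldWeight (f : Sphere → Sphere) (ν : Sphere → ℕ) : Prop :=
  IsCompatibleWeight f ν ∧ ∀ μ, IsCompatibleWeight f μ → ∀ x, ν x ∣ μ x

/-- Euclidean NET maps: NET maps whose canonical orbifold has signature `(2, 2, 2, 2)`, that is,
whose orbifold weight is `2` at exactly four points and `1` elsewhere. -/
def IsEuclideanNETMap (f : Sphere → Sphere) : Prop :=
  IsNETMap f ∧ ∃ ν, IsOrbifoldWeight f ν ∧ {x | ν x = 2}.ncard = 4 ∧ ∀ x, ν x = 1 ∨ ν x = 2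

/-- `π` is, up to an orientation-preserving identification of `ℝ² / Γ` with the sphere, the
canonical quotient map `ℝ² → ℝ² / Γ`, where `Γ` is the group of all `x ↦ 2λ ± x` with `λ ∈ Λ`.
Off `Λ` the map `π` is a local homeomorphism, and orientation is tested there (at points not sent
to `∞`, which loses nothing). -/
structure IsHalfTurnQuotient (Λ : Submodule ℤ ℂ) (π : ℂ → Sphere) : Prop where
  quotient : IsQuotientMap π
  fiber : ∀ x y, π x = π y ↔ ∃ l ∈ Λ, y = 2 * l + x ∨ y = 2 * l - x
  oriented : ∀ x w : ℂ, x ∉ Λ → π x = (w : Sphere) → WindsPositively π x w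

/-- The lattices and quotient maps attached to a NET map `f`: `π₂ (Λ₂)` is the postcritical set of
`f`, `π₁ (Λ₁)` is the set of noncritical points which `f` maps to the postcritical set, and
`f ∘ π₁ = π₂`. (It follows that `Λ₁` is a proper sublattice of `Λ₂`.) -/
structure IsUniformization (f : Sphere → Sphere) (Λ₁ Λ₂ : Submodule ℤ ℂ)
    (π₁ π₂ : ℂ → Sphere) : Prop where
  quotient₁ : IsHalfTurnQuotient Λ₁ π₁
  quotient₂ : IsHalfTurnQuotient Λ₂ π₂
  image₁ : π₁ '' (Λ₁ : Set ℂ) = {x | x ∉ criticalSet f ∧ f x ∈ postcriticalSet f}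
  image₂ : π₂ '' (Λ₂ : Set ℂ) = postcriticalSet f
  comp : f ∘ π₁ = π₂

/-- The sphere map `g` lifts via `π` to the plane map `Φ`. -/
def LiftsVia (π : ℂ → Sphere) (g : Sphere → Sphere) (Φ : ℂ → ℂ) : Prop :=
  g ∘ π = π ∘ Φ

end NETMap

namespace NETMap

open Complex

/-! From `f ∘ π₁ = π₂` and `g ∘ π₁ = π₁ ∘ Φ` one gets `π₂ = h ∘ π₁ ∘ Φ`, hence `ψ ∘ f ∘ π₁ = h ∘ π₁
∘ Φ ∘ Ψ`. So `g' = h⁻¹ ∘ ψ ∘ f` lifts to `Φ ∘ Ψ`, and surjectivity of `π₁` makes it unique.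

That `g'` is Euclidean NET follows from the criterion `LiftsVia.isEuclideanNETMap`, for a continuous
`G` lifting to an affine `A` that maps `Λ` into itself. As `π` is a local homeomorphism off `Λ` and
looks like squaring at `Λ`, `G` has degree 2 exactly at the `π x` with `x ∉ Λ`, `A x ∈ Λ`. Thus
`π(Λ)` contains the postcritical set; a counting argument gives equality once `A.linear` sends some
`v ∉ Λ` into `Λ` (`LiftsVia.postcriticalSet_eq`).

Since `h` may reverse orientation, orientation is carried by the lifts: an integer index,
multiplicative under composition, passes between a sphere map and its affine lift
(`LiftsVia.hasIndex`). -/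

theorem eq_of_exp_eq_one_of_isPreconnected {X : Type*} [TopologicalSpace X] {S : Set X}
    (hS : IsPreconnected S) {D : X → ℂ} (hD : ContinuousOn D S) (h1 : ∀ x ∈ S, exp (D x) = 1)
    {x y : X} (hx : x ∈ S) (hy : y ∈ S) : D x = D y := by
  -- Dividing by `2πi` turns `D` into a continuous function with values in the discrete set of
  -- integers, constant on a preconnected set.
  have hT : IsDiscrete (Set.range ((↑) : ℤ → ℝ)) :=
    ⟨Int.isClosedEmbedding_coe_real.isEmbedding.toHomeomorph.symm.isEmbedding.discreteTopology⟩
  have hint : ∀ x ∈ S, ∃ n : ℤ, D x = n * (2 * Real.pi * I) := fun x hx =>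
    Complex.exp_eq_one_iff.1 (h1 x hx)
  have hpi : (2 * Real.pi * I : ℂ) ≠ 0 := Complex.two_pi_I_ne_zero
  have hval : ∀ x ∈ S, ∃ n : ℤ, D x = n * (2 * Real.pi * I) ∧ (D x / (2 * Real.pi * I)).re = n := by
    intro x hx
    obtain ⟨n, hn⟩ := hint x hx
    refine ⟨n, hn, ?_⟩
    rw [hn, mul_div_cancel_right₀ _ hpi]
    simp
  have hconst : (D x / (2 * Real.pi * I)).re = (D y / (2 * Real.pi * I)).re := by
    refine hS.constant_of_mapsTo hT (f := fun x => (D x / (2 * Real.pi * I)).re) ?_ ?_ hx hy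
    · exact Complex.continuous_re.comp_continuousOn (hD.div_const _)
    · intro z hz
      obtain ⟨n, -, hn⟩ := hval z hz
      exact ⟨n, hn.symm⟩
  obtain ⟨n, hn, hn'⟩ := hval x hx
  obtain ⟨m, hm, hm'⟩ := hval y hy
  rw [hn', hm'] at hconst
  rw [hn, hm, show n = m by exact_mod_cast hconst]

/-! ### Local index of plane maps -/

/-- `d` is the local index of `u` at `z`: in logarithmic coordinates centred at `z` and `u z`, the
map `u` lifts to a map `L` of a left half-plane with `L (ζ + 2πi) = L ζ + 2πi d`. -/
def HasIndex (u : ℂ → ℂ) (z : ℂ) (d : ℤ) : Prop :=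
  ∃ ρ : ℝ, ∃ L : ℂ → ℂ, ContinuousOn L {ζ | ζ.re < ρ} ∧ ∀ ζ : ℂ, ζ.re < ρ →
    u (z + exp ζ) = u z + exp (L ζ) ∧ L (ζ + 2 * Real.pi * I) = L ζ + d * (2 * Real.pi * I)

theorem exists_re_lt_imp_norm_exp_lt {δ : ℝ} (hδ : 0 < δ) (ρ : ℝ) :
    ∃ σ ≤ ρ, ∀ ζ : ℂ, ζ.re < σ → ‖exp ζ‖ < δ := by
  refine ⟨min ρ (Real.log δ), min_le_left _ _, fun ζ hζ => ?_⟩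
  rw [Complex.norm_exp, ← Real.lt_log_iff_exp_lt hδ]
  exact hζ.trans_le (min_le_right _ _)

theorem re_add_two_pi_I (ζ : ℂ) : (ζ + 2 * Real.pi * I).re = ζ.re := by simp

theorem re_add_int_mul_two_pi_I (ζ : ℂ) (n : ℤ) : (ζ + n * (2 * Real.pi * I)).re = ζ.re := by
  simp

theorem convex_re_lt (ρ : ℝ) : Convex ℝ {ζ : ℂ | ζ.re < ρ} :=
  convex_halfSpace_re_lt ρ

theorem lift_add_int_mul {ρ : ℝ} {L : ℂ → ℂ} {d : ℤ}
    (hL : ∀ ζ : ℂ, ζ.re < ρ → L (ζ + 2 * Real.pi * I) = L ζ + d * (2 * Real.pi * I)) (n : ℤ)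
    {ζ : ℂ} (hζ : ζ.re < ρ) :
    L (ζ + n * (2 * Real.pi * I)) = L ζ + (d * n : ℤ) * (2 * Real.pi * I) := by
  induction n with
  | zero => simp
  | succ n ih =>
    have h := hL (ζ + (n : ℤ) * (2 * Real.pi * I)) (by rwa [re_add_int_mul_two_pi_I])
    rw [ih] at h
    have e : ζ + ((n + 1 : ℤ) : ℂ) * (2 * Real.pi * I)
        = ζ + (n : ℤ) * (2 * Real.pi * I) + 2 * Real.pi * I := by push_cast; ring
    rw [e, h]; push_cast; ring
  | pred n ih =>
    have h := hL (ζ + ((-n - 1 : ℤ) : ℂ) * (2 * Real.pi * I)) (by rwa [re_add_int_mul_two_pi_I])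
    have e : ζ + ((-n - 1 : ℤ) : ℂ) * (2 * Real.pi * I) + 2 * Real.pi * I
        = ζ + (-n : ℤ) * (2 * Real.pi * I) := by push_cast; ring
    rw [e, ih] at h
    rw [eq_comm, ← sub_eq_iff_eq_add] at h
    rw [← h]; push_cast; ring

theorem HasIndex.congr {u v : ℂ → ℂ} {z : ℂ} {d : ℤ} (hu : HasIndex u z d)
    (huv : u =ᶠ[𝓝 z] v) : HasIndex v z d := by
  obtain ⟨ρ, L, hL, h⟩ := hu
  obtain ⟨δ, hδ, hball⟩ := Metric.eventually_nhds_iff.1 huv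
  obtain ⟨σ, hσ, hσδ⟩ := exists_re_lt_imp_norm_exp_lt hδ ρ
  refine ⟨σ, L, hL.mono fun ζ (hζ : ζ.re < σ) => hζ.trans_le hσ, fun ζ hζ => ?_⟩
  rw [← hball (y := z + exp ζ) (by simpa [dist_eq_norm] using hσδ ζ hζ), ← huv.eq_of_nhds]
  exact h ζ (hζ.trans_le hσ)

/-- Two logarithmic lifts differ by a constant multiple of `2πi`, so they have the same increment.
-/
theorem HasIndex.unique {u : ℂ → ℂ} {z : ℂ} {d e : ℤ} (hd : HasIndex u z d)
    (he : HasIndex u z e) : d = e := by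
  obtain ⟨ρ, L, hL, h⟩ := hd
  obtain ⟨σ, M, hM, k⟩ := he
  set τ := min ρ σ
  have hτ : ∀ ζ : ℂ, ζ.re < τ → ζ.re < ρ ∧ ζ.re < σ := fun ζ hζ => lt_min_iff.1 hζ
  have hc : ContinuousOn (fun ζ => L ζ - M ζ) {ζ : ℂ | ζ.re < τ} :=
    (hL.mono fun ζ hζ => (hτ ζ hζ).1).sub (hM.mono fun ζ hζ => (hτ ζ hζ).2)
  have h0 : ((τ - 1 : ℝ) : ℂ).re < τ := by simp
  have h1 : ((τ - 1 : ℝ) + 2 * Real.pi * I : ℂ).re < τ := by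
    rw [re_add_two_pi_I]; exact h0
  have key := eq_of_exp_eq_one_of_isPreconnected (convex_re_lt τ).isPreconnected hc (fun ζ hζ => by
    rw [exp_sub, div_eq_one_iff_eq (exp_ne_zero _)]
    have := (h ζ (hτ ζ hζ).1).1
    rw [(k ζ (hτ ζ hζ).2).1] at this
    exact (add_left_cancel this).symm) h0 h1
  rw [(h _ (hτ _ h0).1).2, (k _ (hτ _ h0).2).2] at key
  have : (d : ℂ) * (2 * Real.pi * I) = e * (2 * Real.pi * I) := by linear_combination -key
  exact_mod_cast mul_right_cancel₀ Complex.two_pi_I_ne_zero this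

theorem HasIndex.comp {u v : ℂ → ℂ} {z : ℂ} {d e : ℤ} (hv : HasIndex v (u z) e)
    (hu : HasIndex u z d) (hc : ContinuousAt u z) : HasIndex (v ∘ u) z (e * d) := by
  obtain ⟨ρ, L, hL, h⟩ := hu
  obtain ⟨σ, M, hM, k⟩ := hv
  obtain ⟨δ, hδ, hball⟩ := Metric.continuousAt_iff.1 hc (Real.exp σ) (Real.exp_pos σ)
  obtain ⟨τ, hτ, hτδ⟩ := exists_re_lt_imp_norm_exp_lt hδ ρ
  have hre : ∀ ζ : ℂ, ζ.re < τ → (L ζ).re < σ := fun ζ hζ => by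
    have h1 := hball (x := z + exp ζ) (by simpa [dist_eq_norm] using hτδ ζ hζ)
    rw [(h ζ (hζ.trans_le hτ)).1, dist_eq_norm, add_sub_cancel_left, Complex.norm_exp] at h1
    exact Real.exp_lt_exp.1 h1
  refine ⟨τ, M ∘ L, hM.comp (hL.mono fun ζ (hζ : ζ.re < τ) => hζ.trans_le hτ) hre, fun ζ hζ => ?_⟩
  obtain ⟨h1, h2⟩ := h ζ (hζ.trans_le hτ)
  refine ⟨?_, ?_⟩
  · simp only [Function.comp_apply]
    rw [h1, (k _ (hre ζ hζ)).1]
  · simp only [Function.comp_apply]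
    rw [h2, lift_add_int_mul (fun ζ hζ => (k ζ hζ).2) d (hre ζ hζ)]

/-- Injectivity keeps `u (y + exp ζ) - u y` away from zero. Taking its logarithm jointly in `(y, ζ)`
over a convex set yields one index for all nearby `y`, not just one for each. -/
theorem exists_hasIndex_of_injOn {u : ℂ → ℂ} {z : ℂ} {r : ℝ} (hr : 0 < r)
    (hc : ContinuousOn u (Metric.ball z r)) (hi : Set.InjOn u (Metric.ball z r)) :
    ∃ d, ∀ y ∈ Metric.ball z (r / 2), HasIndex u y d := by
  obtain ⟨ρ, -, hρ⟩ := exists_re_lt_imp_norm_exp_lt (half_pos hr) 0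
  set S : Set (ℂ × ℂ) := Metric.ball z (r / 2) ×ˢ {ζ : ℂ | ζ.re < ρ}
  have hSc : Convex ℝ S := (convex_ball z (r / 2)).prod (convex_re_lt ρ)
  have hSo : IsOpen S := Metric.isOpen_ball.prod (isOpen_lt Complex.continuous_re continuous_const)
  have hSn : S.Nonempty := ⟨(z, (ρ - 1 : ℝ)), by simp [S, hr]⟩
  have hmem1 : ∀ p ∈ S, p.1 ∈ Metric.ball z r := fun p hp =>
    Metric.ball_subset_ball (by linarith) hp.1
  have hmem2 : ∀ p ∈ S, p.1 + exp p.2 ∈ Metric.ball z r := fun p hp => by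
    have h1 := hρ _ hp.2
    have h2 : ‖p.1 - z‖ < r / 2 := by simpa [dist_eq_norm] using hp.1
    rw [Metric.mem_ball, dist_eq_norm]
    calc ‖p.1 + exp p.2 - z‖ = ‖(p.1 - z) + exp p.2‖ := by ring_nf
      _ ≤ ‖p.1 - z‖ + ‖exp p.2‖ := norm_add_le _ _
      _ < r := by linarith
  have hsc : IsSimplyConnected S := by
    have := hSc.contractibleSpace hSn
    change SimplyConnectedSpace S
    infer_instance
  obtain ⟨L, hL, hexp⟩ := exists_continuousOn_eqOn_exp_comp hsc hSo
    (g := fun p => u (p.1 + exp p.2) - u p.1)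
    (((hc.comp (by fun_prop) hmem2)).sub (hc.comp (by fun_prop) hmem1)) (by
      rintro ⟨p, hp, h0⟩
      have := hi (hmem2 p hp) (hmem1 p hp) (sub_eq_zero.1 h0)
      simp at this)
  have hT : ∀ p ∈ S, (p.1, p.2 + 2 * Real.pi * I) ∈ S := fun p hp =>
    ⟨hp.1, by simpa using hp.2⟩
  have hD : ContinuousOn (fun p : ℂ × ℂ => L (p.1, p.2 + 2 * Real.pi * I) - L p) S :=
    (hL.comp (by fun_prop) hT).sub hL
  have hD1 : ∀ p ∈ S, exp (L (p.1, p.2 + 2 * Real.pi * I) - L p) = 1 := fun p hp => by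
    have h1 := hexp (hT p hp)
    have h2 := hexp hp
    simp only [Function.comp_apply] at h1 h2
    rw [exp_sub, div_eq_one_iff_eq (exp_ne_zero _), h1, h2, exp_periodic]
  obtain ⟨p₀, hp₀⟩ := hSn
  obtain ⟨d, hd⟩ := Complex.exp_eq_one_iff.1 (hD1 p₀ hp₀)
  refine ⟨d, fun y hy => ⟨ρ, fun ζ => L (y, ζ), hL.comp (by fun_prop) fun ζ hζ => ⟨hy, hζ⟩,
    fun ζ hζ => ⟨?_, ?_⟩⟩⟩
  · have h2 := hexp (show (y, ζ) ∈ S from ⟨hy, hζ⟩)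
    simp only [Function.comp_apply] at h2
    rw [h2]; ring
  · have h := eq_of_exp_eq_one_of_isPreconnected hSc.isPreconnected hD hD1
      (show (y, ζ) ∈ S from ⟨hy, hζ⟩) hp₀
    simp only at h
    rw [hd] at h
    rw [← h]; ring

/-! ### Index and winding on the sphere -/

/-- The affine coordinate on the sphere, with junk value `0` at `∞`. -/
def coord (p : Sphere) : ℂ := p.elim 0 id

@[simp] theorem coord_coe (z : ℂ) : coord (z : Sphere) = z := rfl

theorem coe_coord {p : Sphere} (hp : p ≠ OnePoint.infty) : (coord p : Sphere) = p := by
  induction p using OnePoint.rec with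
  | infty => exact absurd rfl hp
  | coe z => rfl

theorem continuousAt_coord (z : ℂ) : ContinuousAt coord (z : Sphere) := by
  rw [OnePoint.continuousAt_coe]
  exact continuousAt_id

/-- The circle of radius `r` about `z` is the vertical line `re ζ = log r` in logarithmic
coordinates. -/
theorem windsPositively_iff_hasIndex {U : ℂ → Sphere} {z w : ℂ} {d : ℤ} (hU : ContinuousAt U z)
    (hw : U z = w) (hd : HasIndex (coord ∘ U) z d) : WindsPositively U z w ↔ d = 1 := by
  obtain ⟨ρ, L, hL, h⟩ := hd
  have hUz : coord (U z) = w := by rw [hw, coord_coe]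
  simp only [Function.comp_apply, hUz] at h
  have hpt : ∀ {r : ℝ} (_ : 0 < r) (t : ℝ),
      exp ((Real.log r : ℝ) + t * I) = r * exp (t * I) := fun hr t => by
    rw [exp_add, ← Complex.ofReal_exp, Real.exp_log hr]
  have hr : ∀ᶠ r : ℝ in 𝓝[>] 0, 0 < r ∧ Real.log r < ρ := by
    filter_upwards [Ioo_mem_nhdsGT (Real.exp_pos ρ)] with r hr
    exact ⟨hr.1, (Real.log_lt_iff_lt_exp hr.1).2 hr.2⟩
  have hre : ∀ {r : ℝ} (_ : Real.log r < ρ) (t : ℝ),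
      ((Real.log r : ℝ) + t * I : ℂ).re < ρ := fun hr t => by simpa using hr
  have hcont : ∀ {r : ℝ} (_ : Real.log r < ρ),
      Continuous fun t : ℝ => L ((Real.log r : ℝ) + t * I) := fun hr =>
    hL.comp_continuous (by fun_prop) (hre hr)
  have htwo : ∀ {r : ℝ} (_ : Real.log r < ρ), L ((Real.log r : ℝ) + (2 * Real.pi : ℝ) * I)
      = L ((Real.log r : ℝ) + (0 : ℝ) * I) + d * (2 * Real.pi * I) := fun hr => by
    rw [← (h _ (hre hr 0)).2]; push_cast; ring_nf
  constructor
  · intro hW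
    obtain ⟨r, ⟨M, hM, hM2, hMU⟩, hr0, hrρ⟩ := (hW.and hr).exists
    have key := eq_of_exp_eq_one_of_isPreconnected isPreconnected_univ
      (D := fun t : ℝ => M t - L ((Real.log r : ℝ) + t * I))
      (hM.sub (hcont hrρ)).continuousOn (fun t _ => by
        rw [exp_sub, div_eq_one_iff_eq (exp_ne_zero _)]
        have h1 := (h _ (hre hrρ t)).1
        rw [hpt hr0, hMU, coord_coe] at h1
        exact add_left_cancel h1) (Set.mem_univ (2 * Real.pi)) (Set.mem_univ 0)
    rw [htwo hrρ, hM2] at key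
    have : (d : ℂ) * (2 * Real.pi * I) = (1 : ℤ) * (2 * Real.pi * I) := by
      push_cast; linear_combination -key
    exact_mod_cast mul_right_cancel₀ Complex.two_pi_I_ne_zero this
  · rintro rfl
    have hfin : ∀ᶠ y in 𝓝 z, U y ≠ OnePoint.infty :=
      hU.eventually_ne (by rw [hw]; exact OnePoint.coe_ne_infty w)
    obtain ⟨δ, hδ, hball⟩ := Metric.eventually_nhds_iff.1 hfin
    filter_upwards [hr, Ioo_mem_nhdsGT hδ] with r ⟨hr0, hrρ⟩ hrδ
    refine ⟨fun t => L ((Real.log r : ℝ) + t * I), hcont hrρ, ?_, fun t => ?_⟩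
    · simpa using htwo hrρ
    · rw [← (h _ (hre hrρ t)).1, hpt hr0, coe_coord]
      refine hball ?_
      rw [dist_eq_norm, add_sub_cancel_left, norm_mul, Complex.norm_exp_ofReal_mul_I]
      simpa [abs_of_pos hr0] using hrδ.2

/-! ### Local degree as a count of nearby preimages -/

theorem encard_setOf_pow_eq_le {k : ℕ} (hk : 1 ≤ k) (c : ℂ) : {z : ℂ | z ^ k = c}.encard ≤ k := by
  classical
  have h : {z : ℂ | z ^ k = c} = ((Polynomial.nthRoots k c).toFinset : Set ℂ) := by
    ext z; simp [Polynomial.mem_nthRoots hk]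
  rw [h, Set.encard_coe_eq_coe_finsetCard]
  exact_mod_cast (Multiset.toFinset_card_le _).trans (Polynomial.card_nthRoots k c)

/-- With the matching lower bound below, this characterises `k` without charts, so the degree does
not depend on them. -/
theorem HasLocalDegree.exists_encard_le {f : Sphere → Sphere} {x : Sphere} {k : ℕ}
    (hf : HasLocalDegree f x k) : ∃ U ∈ 𝓝 x, ∀ y, (U ∩ f ⁻¹' {y}).encard ≤ k := by
  obtain ⟨hk, φ, χ, hx, -, -, -, hev⟩ := hf
  refine ⟨_, inter_mem (φ.open_source.mem_nhds hx) hev, fun y => ?_⟩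
  refine le_trans ?_ (encard_setOf_pow_eq_le hk (χ y))
  refine Set.encard_le_encard_of_injOn (f := φ) ?_ ?_
  · rintro p ⟨⟨-, hp⟩, rfl⟩
    exact hp.2.symm
  · exact φ.injOn.mono fun p hp => hp.1.1

theorem HasLocalDegree.exists_le_encard {f : Sphere → Sphere} {x : Sphere} {k : ℕ}
    (hf : HasLocalDegree f x k) {U : Set Sphere} (hU : U ∈ 𝓝 x) :
    ∃ y, (k : ℕ∞) ≤ (U ∩ f ⁻¹' {y}).encard := by
  obtain ⟨hk, φ, χ, hx, hx0, -, -, hev⟩ := hf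
  have hsymm : φ.symm 0 = x := by rw [← hx0, φ.left_inv hx]
  have h0 : (0 : ℂ) ∈ φ.target := hx0 ▸ φ.map_source hx
  have hcont : ContinuousAt φ.symm 0 := φ.continuousAt_symm h0
  have hnear : ∀ᶠ z in 𝓝 (0 : ℂ), z ∈ φ.target ∧ φ.symm z ∈ U ∧
      f (φ.symm z) ∈ χ.source ∧ χ (f (φ.symm z)) = φ (φ.symm z) ^ k := by
    refine (show ∀ᶠ z in 𝓝 (0 : ℂ), z ∈ φ.target from φ.open_target.mem_nhds h0).and ?_
    have hx' : Tendsto φ.symm (𝓝 0) (𝓝 x) := hsymm ▸ hcont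
    exact hx'.eventually ((show ∀ᶠ y in 𝓝 x, y ∈ U from hU).and hev)
  obtain ⟨ε, hε, hball⟩ := Metric.eventually_nhds_iff.1 hnear
  have hω := Complex.isPrimitiveRoot_exp k (by omega)
  set ω := Complex.exp (2 * Real.pi * Complex.I / k)
  -- The `k` rotations of `ε / 2` by roots of unity share one `k`-th power, hence one image under
  -- `f`.
  set z : ℕ → ℂ := fun j => (ε / 2 : ℝ) * ω ^ j
  have hz : ∀ j, dist (z j) 0 < ε := fun j => by
    rw [dist_zero_right, norm_mul, norm_pow, hω.norm'_eq_one (by omega), one_pow, mul_one,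
      Complex.norm_real, Real.norm_of_nonneg (by linarith)]
    linarith
  have hzk : ∀ j, z j ^ k = ((ε / 2 : ℝ) : ℂ) ^ k := fun j => by
    simp only [z]
    rw [mul_pow, ← pow_mul, mul_comm j k, pow_mul, hω.pow_eq_one, one_pow, mul_one]
  refine ⟨f (φ.symm (z 0)), ?_⟩
  have hrange : (Set.univ : Set (Fin k)).encard = k := by simp
  rw [← hrange]
  refine Set.encard_le_encard_of_injOn (f := fun j : Fin k => φ.symm (z j)) ?_ ?_
  · intro j _
    obtain ⟨h1, h2, h3, h4⟩ := hball (hz j)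
    obtain ⟨g1, -, g3, g4⟩ := hball (hz 0)
    refine ⟨h2, χ.injOn h3 g3 ?_⟩
    rw [h4, g4, φ.right_inv h1, φ.right_inv g1, hzk, hzk]
  · intro i _ j _ hij
    have h1 := φ.symm.injOn (hball (hz i)).1 (hball (hz j)).1 hij
    have h2 : ((ε / 2 : ℝ) : ℂ) ≠ 0 := by
      rw [Complex.ofReal_ne_zero]; positivity
    exact Fin.ext (hω.pow_inj i.2 j.2 (mul_left_cancel₀ h2 h1))

theorem HasLocalDegree.unique {f : Sphere → Sphere} {x : Sphere} {k m : ℕ}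
    (hk : HasLocalDegree f x k) (hm : HasLocalDegree f x m) : k = m := by
  have key : ∀ {k m : ℕ}, HasLocalDegree f x k → HasLocalDegree f x m → k ≤ m := by
    intro k m hk hm
    obtain ⟨U, hU, hle⟩ := hm.exists_encard_le
    obtain ⟨y, hy⟩ := hk.exists_le_encard hU
    exact_mod_cast hy.trans (hle y)
  exact le_antisymm (key hk hm) (key hm hk)

theorem HasLocalDegree.le_one_of_injective {f : Sphere → Sphere} (hf : Function.Injective f)
    {x : Sphere} {k : ℕ} (hk : HasLocalDegree f x k) : k ≤ 1 := by
  obtain ⟨y, hy⟩ := hk.exists_le_encard univ_mem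
  refine Nat.cast_le.1 (hy.trans ?_)
  rw [Set.univ_inter, Nat.cast_one, Set.encard_le_one_iff]
  intro a b ha hb
  exact hf (ha.trans hb.symm)

theorem HasLocalDegree.exists_injOn {f : Sphere → Sphere} {x : Sphere}
    (hf : HasLocalDegree f x 1) : ∃ U ∈ 𝓝 x, Set.InjOn f U := by
  obtain ⟨U, hU, hle⟩ := hf.exists_encard_le
  refine ⟨U, hU, fun a ha b hb hab => ?_⟩
  exact Set.encard_le_one_iff.1 (hle (f b)) a b ⟨ha, hab⟩ ⟨hb, rfl⟩

/-! ### Charts from local parametrizations -/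

/-- A continuous open map from the plane which is injective near `0`; its local inverse at `0` is a
chart of the sphere centred at `e 0`. -/
structure IsLocalParametrization (e : ℂ → Sphere) : Prop where
  continuous : Continuous e
  isOpenMap : IsOpenMap e
  exists_injOn : ∃ s ∈ 𝓝 0, Set.InjOn e s

theorem IsLocalParametrization.exists_chart {e : ℂ → Sphere} (he : IsLocalParametrization e) :
    ∃ φ : OpenPartialHomeomorph Sphere ℂ, e 0 ∈ φ.source ∧
      ∀ᶠ w in 𝓝 0, e w ∈ φ.source ∧ φ (e w) = w := by
  obtain ⟨hc, ho, s, hs, hi⟩ := he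
  set E : OpenPartialHomeomorph ℂ Sphere := OpenPartialHomeomorph.ofContinuousOpen
    ((hi.mono interior_subset).toPartialEquiv e (interior s)) hc.continuousOn ho isOpen_interior
  have h : ∀ w ∈ interior s, e w ∈ E.symm.source ∧ E.symm (e w) = w := fun w hw =>
    ⟨E.map_source hw, E.left_inv hw⟩
  refine ⟨E.symm, (h 0 (mem_interior_iff_mem_nhds.2 hs)).1, ?_⟩
  filter_upwards [interior_mem_nhds.2 hs] with w hw using h w hw

theorem hasLocalDegree_of_semiconj {G : Sphere → Sphere} {e₁ e₂ : ℂ → Sphere} {k : ℕ} (hk : 1 ≤ k)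
    (h₁ : IsLocalParametrization e₁) (h₂ : IsLocalParametrization e₂)
    (hG : ∀ w, G (e₁ w) = e₂ (w ^ k)) : HasLocalDegree G (e₁ 0) k := by
  obtain ⟨φ, hφ, hφe⟩ := h₁.exists_chart
  obtain ⟨χ, hχ, hχe⟩ := h₂.exists_chart
  have hG0 : G (e₁ 0) = e₂ 0 := by rw [hG, zero_pow (by omega)]
  refine ⟨hk, φ, χ, hφ, hφe.self_of_nhds.2, hG0 ▸ hχ, by rw [hG0]; exact hχe.self_of_nhds.2, ?_⟩
  refine (h₁.isOpenMap.nhds_le 0) (eventually_map.2 ?_)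
  have hpow : Tendsto (fun w : ℂ => w ^ k) (𝓝 0) (𝓝 0) := by
    have : ContinuousAt (fun w : ℂ => w ^ k) 0 := by fun_prop
    simpa [ContinuousAt, zero_pow (show k ≠ 0 by omega)] using this
  filter_upwards [hφe, hpow.eventually hχe] with w h1 h2
  rw [hG, h1.2]
  exact h2

/-! ### Local structure of the half-turn quotient -/

variable {Λ : Submodule ℤ ℂ} {π : ℂ → Sphere}

theorem exists_norm_lt_imp_eq_zero (Λ : Submodule ℤ ℂ) [DiscreteTopology Λ] :
    ∃ ε > 0, ∀ l ∈ Λ, ‖l‖ < ε → l = 0 := by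
  obtain ⟨ε, hε, h⟩ := Metric.exists_ball_inter_eq_singleton_of_mem_discrete
    (s := (Λ : Set ℂ)) (⟨inferInstanceAs (DiscreteTopology Λ)⟩) (zero_mem Λ)
  refine ⟨ε, hε, fun l hl hlε => ?_⟩
  have : l ∈ Metric.ball 0 ε ∩ (Λ : Set ℂ) := ⟨by simpa using hlε, hl⟩
  rw [h] at this
  exact this

theorem isClosed_of_discreteTopology (Λ : Submodule ℤ ℂ) [DiscreteTopology Λ] :
    IsClosed (Λ : Set ℂ) :=
  @AddSubgroup.isClosed_of_discrete _ _ _ _ _ Λ.toAddSubgroup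
    (inferInstanceAs (DiscreteTopology Λ))

theorem countable_of_discreteTopology (Λ : Submodule ℤ ℂ) [DiscreteTopology Λ] :
    (Λ : Set ℂ).Countable :=
  Set.countable_coe_iff.1 (TopologicalSpace.separableSpace_iff_countable.1
    (inferInstanceAs (TopologicalSpace.SeparableSpace Λ)))

theorem affineEquiv_apply_add (A : ℂ ≃ᵃ[ℝ] ℂ) (x u : ℂ) : A (x + u) = A x + A.linear u := by
  have := A.map_vadd x u
  simpa [add_comm] using this

theorem continuous_affineEquiv (A : ℂ ≃ᵃ[ℝ] ℂ) : Continuous A :=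
  A.toAffineMap.continuous_of_finiteDimensional

namespace IsHalfTurnQuotient

theorem isOpenMap (hπ : IsHalfTurnQuotient Λ π) : IsOpenMap π := by
  intro U hU
  rw [← hπ.quotient.isOpen_preimage]
  -- The saturation of `U` is the union of its images under the group, each of them open.
  have : π ⁻¹' (π '' U) = ⋃ l ∈ Λ, ((fun y => y - 2 * l) ⁻¹' U ∪ (fun y => 2 * l - y) ⁻¹' U) := by
    ext y
    simp only [Set.mem_preimage, Set.mem_image, Set.mem_iUnion, Set.mem_union, exists_prop]
    constructor
    · rintro ⟨x, hx, hxy⟩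
      obtain ⟨l, hl, rfl | rfl⟩ := (hπ.fiber x y).1 hxy
      · exact ⟨l, hl, Or.inl (by simpa using hx)⟩
      · exact ⟨l, hl, Or.inr (by simpa using hx)⟩
    · rintro ⟨l, hl, h | h⟩
      · exact ⟨_, h, (hπ.fiber _ _).2 ⟨l, hl, Or.inl (by ring)⟩⟩
      · exact ⟨_, h, (hπ.fiber _ _).2 ⟨l, hl, Or.inr (by ring)⟩⟩
  rw [this]
  exact isOpen_biUnion fun l _ =>
    (hU.preimage (by fun_prop)).union (hU.preimage (by fun_prop))

theorem mem_iff_of_eq (hπ : IsHalfTurnQuotient Λ π) {x y : ℂ} (hxy : π x = π y) :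
    x ∈ Λ ↔ y ∈ Λ := by
  obtain ⟨l, hl, h⟩ := (hπ.fiber x y).1 hxy
  have h2 : 2 * l ∈ Λ := by rw [two_mul]; exact add_mem hl hl
  rcases h with rfl | rfl
  · exact (Submodule.add_mem_iff_right Λ h2).symm
  · exact (Submodule.sub_mem_iff_right Λ h2).symm

theorem mem_image_iff (hπ : IsHalfTurnQuotient Λ π) {x : ℂ} :
    π x ∈ π '' (Λ : Set ℂ) ↔ x ∈ Λ :=
  ⟨fun ⟨_, hy, hyx⟩ => (hπ.mem_iff_of_eq hyx).1 hy, fun hx => ⟨x, hx, rfl⟩⟩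

/-- Discreteness excludes short translations, and a half-turn pairing two points near `x` would have
its centre, a lattice point, near `x`. -/
theorem exists_injOn (hπ : IsHalfTurnQuotient Λ π) [DiscreteTopology Λ] {x : ℂ} (hx : x ∉ Λ) :
    ∃ s ∈ 𝓝 x, Set.InjOn π s := by
  obtain ⟨ε, hε, hΛ⟩ := exists_norm_lt_imp_eq_zero Λ
  obtain ⟨δ, hδ, hball⟩ := Metric.mem_nhds_iff.1
    ((isClosed_of_discreteTopology Λ).isOpen_compl.mem_nhds hx)
  refine ⟨Metric.ball x (min ε δ), Metric.ball_mem_nhds x (lt_min hε hδ), fun y hy z hz hyz => ?_⟩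
  rw [Metric.mem_ball, dist_eq_norm, lt_min_iff] at hy hz
  obtain ⟨l, hl, rfl | rfl⟩ := (hπ.fiber y z).1 hyz
  · have h2 : ‖(2 : ℂ) * l‖ < 2 * ε := by
      calc ‖2 * l‖ = ‖(2 * l + y - x) - (y - x)‖ := by ring_nf
        _ ≤ ‖2 * l + y - x‖ + ‖y - x‖ := norm_sub_le _ _
        _ < 2 * ε := by linarith [hz.1, hy.1]
    rw [norm_mul, Complex.norm_ofNat] at h2
    rw [hΛ l hl (by linarith)]; ring
  · exfalso
    refine @hball l ?_ hl
    have h2 : ‖(2 : ℂ) * (l - x)‖ < 2 * δ := by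
      calc ‖2 * (l - x)‖ = ‖(2 * l - y - x) + (y - x)‖ := by ring_nf
        _ ≤ ‖2 * l - y - x‖ + ‖y - x‖ := norm_add_le _ _
        _ < 2 * δ := by linarith [hz.2, hy.2]
    rw [norm_mul, Complex.norm_ofNat] at h2
    rw [Metric.mem_ball, dist_eq_norm]; linarith

theorem isLocalParametrization_comp (hπ : IsHalfTurnQuotient Λ π) [DiscreteTopology Λ]
    (a : ℂ ≃ₜ ℂ) (ha : a 0 ∉ Λ) : IsLocalParametrization (fun w => π (a w)) := by
  obtain ⟨s, hs, hi⟩ := hπ.exists_injOn ha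
  refine ⟨hπ.quotient.continuous.comp a.continuous, hπ.isOpenMap.comp a.isOpenMap, a ⁻¹' s,
    a.continuous.continuousAt.preimage_mem_nhds hs, fun w hw z hz h => ?_⟩
  exact a.injective (hi hw hz h)

/-- By `hneg`, `u ↦ -u` corresponds to the half-turn about the lattice point `a 0`, so `π ∘ a` is
even and descends through squaring. Near `a 0` only that half-turn and the identity identify points.
-/
theorem exists_isLocalParametrization_sq (hπ : IsHalfTurnQuotient Λ π) [DiscreteTopology Λ]
    (a : ℂ ≃ₜ ℂ) (ha : a 0 ∈ Λ) (hneg : ∀ u, a (-u) = 2 * a 0 - a u) :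
    ∃ e : ℂ → Sphere, IsLocalParametrization e ∧ ∀ u, e (u ^ 2) = π (a u) := by
  have hq := Complex.isOpenQuotientMap_pow 2
  -- `r` is an arbitrary, possibly discontinuous, square root; continuity of `e` comes from squaring
  -- being a quotient map.
  choose r hr using hq.surjective
  have heven : ∀ u v : ℂ, u ^ 2 = v ^ 2 → π (a u) = π (a v) := fun u v huv => by
    rcases sq_eq_sq_iff_eq_or_eq_neg.1 huv with rfl | rfl
    · rfl
    · exact (hπ.fiber _ _).2 ⟨a 0, ha, Or.inr (by rw [hneg]; ring)⟩
  have he : ∀ u, π (a (r (u ^ 2))) = π (a u) := fun u => heven _ _ (hr _)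
  have hcomp : (fun w => π (a (r w))) ∘ (fun u : ℂ => u ^ 2) = fun u => π (a u) := funext he
  have hopen : IsOpenMap fun u => π (a u) := hπ.isOpenMap.comp a.isOpenMap
  refine ⟨fun w => π (a (r w)), ⟨?_, ?_, ?_⟩, he⟩
  · rw [hq.isQuotientMap.continuous_iff, hcomp]
    exact hπ.quotient.continuous.comp a.continuous
  · intro V hV
    have : (fun w => π (a (r w))) '' V = (fun u => π (a u)) '' ((fun u : ℂ => u ^ 2) ⁻¹' V) := by
      rw [← hcomp, Set.image_comp, Set.image_preimage_eq _ hq.surjective]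
    rw [this]
    exact hopen _ (hV.preimage hq.continuous)
  · obtain ⟨ε, hε, hΛ⟩ := exists_norm_lt_imp_eq_zero Λ
    refine ⟨(fun u : ℂ => u ^ 2) '' (a ⁻¹' Metric.ball (a 0) ε), ?_, ?_⟩
    · have := hq.isOpenMap.image_mem_nhds
        (a.continuous.continuousAt.preimage_mem_nhds (Metric.ball_mem_nhds (a 0) hε))
      simpa using this
    · rintro _ ⟨u, hu, rfl⟩ _ ⟨v, hv, rfl⟩ huv
      simp only [he] at huv
      simp only [Set.mem_preimage, Metric.mem_ball, dist_eq_norm] at hu hv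
      obtain ⟨l, hl, h | h⟩ := (hπ.fiber _ _).1 huv
      · have h2 : ‖(2 : ℂ) * l‖ < 2 * ε := by
          calc ‖2 * l‖ = ‖(a v - a 0) - (a u - a 0)‖ := by rw [h]; ring_nf
            _ ≤ ‖a v - a 0‖ + ‖a u - a 0‖ := norm_sub_le _ _
            _ < 2 * ε := by linarith
        rw [norm_mul, Complex.norm_ofNat] at h2
        rw [hΛ l hl (by linarith), mul_zero, zero_add] at h
        simp only [a.injective h]
      · have h2 : ‖(2 : ℂ) * (l - a 0)‖ < 2 * ε := by
          calc ‖2 * (l - a 0)‖ = ‖(a v - a 0) + (a u - a 0)‖ := by rw [h]; ring_nf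
            _ ≤ ‖a v - a 0‖ + ‖a u - a 0‖ := norm_add_le _ _
            _ < 2 * ε := by linarith
        rw [norm_mul, Complex.norm_ofNat] at h2
        have h3 : l = a 0 := sub_eq_zero.1 (hΛ _ (sub_mem hl ha) (by linarith))
        rw [h3, ← hneg] at h
        simp only [a.injective h, neg_sq]

end IsHalfTurnQuotient

/-- The plane homeomorphism `u ↦ A (x + u)`. -/
noncomputable def affineHomeomorphAt (A : ℂ ≃ᵃ[ℝ] ℂ) (x : ℂ) : ℂ ≃ₜ ℂ :=
  (Homeomorph.addLeft x).trans
    ⟨A.toEquiv, continuous_affineEquiv A, continuous_affineEquiv A.symm⟩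

@[simp] theorem affineHomeomorphAt_apply (A : ℂ ≃ᵃ[ℝ] ℂ) (x u : ℂ) :
    affineHomeomorphAt A x u = A (x + u) := rfl

theorem affineHomeomorphAt_neg (A : ℂ ≃ᵃ[ℝ] ℂ) (x u : ℂ) :
    affineHomeomorphAt A x (-u) = 2 * affineHomeomorphAt A x 0 - affineHomeomorphAt A x u := by
  simp only [affineHomeomorphAt_apply, affineEquiv_apply_add, map_neg, map_zero]
  ring

/-! ### Local degrees of maps with affine lifts -/

section LocalDegree

variable [DiscreteTopology Λ] {G : Sphere → Sphere} {A : ℂ ≃ᵃ[ℝ] ℂ}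

theorem LiftsVia.hasLocalDegree_one (hG : LiftsVia π G A) (hπ : IsHalfTurnQuotient Λ π) {x : ℂ}
    (hx : x ∉ Λ) (hAx : A x ∉ Λ) : HasLocalDegree G (π x) 1 := by
  have h := hasLocalDegree_of_semiconj le_rfl
    (hπ.isLocalParametrization_comp (Homeomorph.addLeft x) (by simpa using hx))
    (hπ.isLocalParametrization_comp (affineHomeomorphAt A x) (by simpa using hAx))
    (fun w => by simpa using congrFun hG (x + w))
  simpa using h

theorem LiftsVia.hasLocalDegree_two (hG : LiftsVia π G A) (hπ : IsHalfTurnQuotient Λ π) {x : ℂ}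
    (hx : x ∉ Λ) (hAx : A x ∈ Λ) : HasLocalDegree G (π x) 2 := by
  obtain ⟨e, he, hsq⟩ := hπ.exists_isLocalParametrization_sq (affineHomeomorphAt A x)
    (by simpa using hAx) (affineHomeomorphAt_neg A x)
  have h := hasLocalDegree_of_semiconj one_le_two
    (hπ.isLocalParametrization_comp (Homeomorph.addLeft x) (by simpa using hx)) he
    (fun w => by simpa [hsq] using congrFun hG (x + w))
  simpa using h

/-- The squarings at source and target cancel. -/
theorem LiftsVia.hasLocalDegree_one_of_mem (hG : LiftsVia π G A) (hπ : IsHalfTurnQuotient Λ π)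
    {x : ℂ} (hx : x ∈ Λ) (hAx : A x ∈ Λ) : HasLocalDegree G (π x) 1 := by
  obtain ⟨e₁, he₁, hsq₁⟩ := hπ.exists_isLocalParametrization_sq (Homeomorph.addLeft x)
    (by simpa using hx) (fun u => by simp only [Homeomorph.coe_addLeft]; ring)
  obtain ⟨e₂, he₂, hsq₂⟩ := hπ.exists_isLocalParametrization_sq (affineHomeomorphAt A x)
    (by simpa using hAx) (affineHomeomorphAt_neg A x)
  have h := hasLocalDegree_of_semiconj (G := G) le_rfl he₁ he₂ (fun w => by
    obtain ⟨u, rfl⟩ := (Complex.isOpenQuotientMap_pow 2).surjective w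
    simpa [hsq₁, hsq₂] using congrFun hG (x + u))
  have h0 : e₁ 0 = π x := by simpa using hsq₁ 0
  rwa [h0] at h

end LocalDegree

/-! ### Orientation of a map and of its lift -/

section Orientation

theorem exists_eventually_hasIndex {U : ℂ → Sphere} (hc : Continuous U) {z : ℂ}
    (hz : U z ≠ OnePoint.infty) {s : Set ℂ} (hs : s ∈ 𝓝 z) (hi : Set.InjOn U s) :
    ∃ d, ∀ᶠ y in 𝓝 z, HasIndex (coord ∘ U) y d := by
  obtain ⟨r, hr, hball⟩ := Metric.mem_nhds_iff.1
    (inter_mem hs (hc.continuousAt.eventually_ne hz))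
  have hcoe : ∀ y ∈ Metric.ball z r, (coord (U y) : Sphere) = U y := fun y hy =>
    coe_coord (hball hy).2
  obtain ⟨d, hd⟩ := exists_hasIndex_of_injOn (u := coord ∘ U) hr
    (fun y hy => by
      have h1 : ContinuousAt coord (U y) := by
        rw [← hcoe y hy]; exact continuousAt_coord _
      exact (h1.comp hc.continuousAt).continuousWithinAt)
    (fun y hy y' hy' h => hi (hball hy).1 (hball hy').1 (by
      rw [← hcoe y hy, ← hcoe y' hy']; exact congrArg _ h))
  exact ⟨d, mem_of_superset (Metric.ball_mem_nhds z (half_pos hr)) hd⟩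

theorem HasIndex.affineEquiv {A : ℂ ≃ᵃ[ℝ] ℂ} {x : ℂ} {d : ℤ} (h : HasIndex A x d) (y : ℂ) :
    HasIndex A y d := by
  obtain ⟨ρ, L, hL, h⟩ := h
  refine ⟨ρ, L, hL, fun ζ hζ => ⟨?_, (h ζ hζ).2⟩⟩
  have := (h ζ hζ).1
  rw [affineEquiv_apply_add] at this ⊢
  rw [add_left_cancel this]

theorem exists_hasIndex_affineEquiv (A : ℂ ≃ᵃ[ℝ] ℂ) (x : ℂ) : ∃ d, HasIndex A x d := by
  obtain ⟨d, hd⟩ := exists_hasIndex_of_injOn (u := A) (z := x) one_pos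
    (continuous_affineEquiv A).continuousOn A.injective.injOn
  exact ⟨d, hd x (by simp)⟩

theorem IsHalfTurnQuotient.hasIndex_one [DiscreteTopology Λ] (hπ : IsHalfTurnQuotient Λ π) {x : ℂ}
    (hx : x ∉ Λ) (hfin : π x ≠ OnePoint.infty) : HasIndex (coord ∘ π) x 1 := by
  obtain ⟨s, hs, hi⟩ := hπ.exists_injOn hx
  obtain ⟨d, hd⟩ := exists_eventually_hasIndex hπ.quotient.continuous hfin hs hi
  have hw := (coe_coord hfin).symm
  have hd1 := (windsPositively_iff_hasIndex hπ.quotient.continuous.continuousAt hw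
    hd.self_of_nhds).1 (hπ.oriented x _ hx hw)
  exact hd1 ▸ hd.self_of_nhds

theorem IsHalfTurnQuotient.countable_preimage_infty [DiscreteTopology Λ]
    (hπ : IsHalfTurnQuotient Λ π) : (π ⁻¹' {OnePoint.infty}).Countable := by
  obtain ⟨x, hx⟩ := hπ.quotient.surjective OnePoint.infty
  have hΛ := countable_of_discreteTopology Λ
  refine ((hΛ.image fun l => 2 * l + x).union (hΛ.image fun l => 2 * l - x)).mono fun y hy => ?_
  obtain ⟨l, hl, rfl | rfl⟩ := (hπ.fiber x y).1 (hx.trans (Eq.symm hy))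
  · exact Or.inl ⟨l, hl, rfl⟩
  · exact Or.inr ⟨l, hl, rfl⟩

variable [DiscreteTopology Λ] {G : Sphere → Sphere} {A : ℂ ≃ᵃ[ℝ] ℂ}

/-- Both sides of `G ∘ π = π ∘ A` are compared at `x`: `π` has index 1, so one side has index `d`
and the other that of `A`. -/
theorem LiftsVia.hasIndex (hG : LiftsVia π G A) (hπ : IsHalfTurnQuotient Λ π)
    {x z : ℂ} (hx : x ∉ Λ) (hAx : A x ∉ Λ) (hz : π x = z) (hfin : π (A x) ≠ OnePoint.infty)
    {d : ℤ} (hd : HasIndex (coord ∘ fun u : ℂ => G u) z d) : HasIndex A x d := by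
  obtain ⟨a, ha⟩ := exists_hasIndex_affineEquiv A x
  have hzfin : π x ≠ OnePoint.infty := by rw [hz]; exact OnePoint.coe_ne_infty z
  have hπc := hπ.quotient.continuous
  have hcz : coord (π x) = z := by rw [hz, coord_coe]
  have h1 := ((hπ.hasIndex_one hAx hfin).comp ha (continuous_affineEquiv A).continuousAt)
  have h2 := HasIndex.comp (u := coord ∘ π) (z := x) (by rwa [Function.comp_apply, hcz])
    (hπ.hasIndex_one hx hzfin) (ContinuousAt.comp (by rw [hz]; exact continuousAt_coord z)
      hπc.continuousAt)
  have h3 := h2.congr (v := (coord ∘ π) ∘ A) (by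
    filter_upwards [hπc.continuousAt.eventually_ne hzfin] with y hy
    simp only [Function.comp_apply, coe_coord hy]
    exact congrArg coord (congrFun hG y))
  have := h1.unique h3
  rw [one_mul, mul_one] at this
  rwa [← this]

theorem LiftsVia.hasIndex_one_of_preservesOrientation (hG : LiftsVia π G A)
    (hπ : IsHalfTurnQuotient Λ π) (hGc : Continuous G) (hGo : PreservesOrientation G) (y : ℂ) :
    HasIndex A y 1 := by
  have hΛ := countable_of_discreteTopology Λ
  have hinf := hπ.countable_preimage_infty
  -- All exceptional points form a countable set, so a generic `x` avoids them; the index of `A` is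
  -- the same everywhere.
  have hbad : ((Λ : Set ℂ) ∪ A ⁻¹' Λ ∪ (π ⁻¹' {OnePoint.infty} ∪
      A ⁻¹' (π ⁻¹' {OnePoint.infty}))).Countable :=
    (hΛ.union (hΛ.preimage A.injective)).union (hinf.union (hinf.preimage A.injective))
  obtain ⟨x, hx⟩ := (hbad.dense_compl ℝ).nonempty
  simp only [Set.mem_compl_iff, Set.mem_union, not_or] at hx
  obtain ⟨⟨hxΛ, hAx⟩, hxfin, hAfin⟩ := hx
  set z := coord (π x)
  have hz : π x = z := (coe_coord hxfin).symm
  have hGz : G z = (coord (π (A x)) : ℂ) := by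
    rw [← hz, coe_coord hAfin]; exact congrFun hG x
  have hdeg : HasLocalDegree G (z : Sphere) 1 := hz ▸ hG.hasLocalDegree_one hπ hxΛ hAx
  have hw := hGo z _ hGz hdeg
  obtain ⟨s, hs, hi⟩ := hdeg.exists_injOn
  have hcc : Continuous fun u : ℂ => G u := hGc.comp OnePoint.continuous_coe
  obtain ⟨d, hd⟩ := exists_eventually_hasIndex hcc (z := z)
    (by rw [hGz]; exact OnePoint.coe_ne_infty _)
    (OnePoint.continuous_coe.continuousAt.preimage_mem_nhds hs)
    (fun u hu v hv h => OnePoint.coe_injective (hi hu hv h))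
  have hd1 := (windsPositively_iff_hasIndex hcc.continuousAt hGz hd.self_of_nhds).1 hw
  subst hd1
  exact (hG.hasIndex hπ hxΛ hAx hz hAfin hd.self_of_nhds).affineEquiv y

theorem LiftsVia.preservesOrientation (hG : LiftsVia π G A) (hπ : IsHalfTurnQuotient Λ π)
    (hGc : Continuous G) (hA : ∀ y, HasIndex A y 1) : PreservesOrientation G := by
  intro z w hzw hdeg
  obtain ⟨s, hs, hi⟩ := hdeg.exists_injOn
  have hcc : Continuous fun u : ℂ => G u := hGc.comp OnePoint.continuous_coe
  have hfin : G z ≠ OnePoint.infty := by rw [hzw]; exact OnePoint.coe_ne_infty _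
  obtain ⟨d, hd⟩ := exists_eventually_hasIndex hcc hfin
    (OnePoint.continuous_coe.continuousAt.preimage_mem_nhds hs)
    (fun u hu v hv h => OnePoint.coe_injective (hi hu hv h))
  have hΛ := countable_of_discreteTopology Λ
  have hbad : (((↑) : ℂ → Sphere) ⁻¹' (π '' Λ ∪ π '' (A ⁻¹' Λ))).Countable :=
    ((hΛ.image π).union ((hΛ.preimage A.injective).image π)).preimage OnePoint.coe_injective
  -- The point `z` itself may be exceptional. The index is constant nearby, so it is computed at a
  -- generic `y`.
  obtain ⟨y, hy, hyd, hyfin⟩ := (hbad.dense_compl ℝ).inter_nhds_nonempty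
    (hd.and (hcc.continuousAt.eventually_ne hfin))
  obtain ⟨x, hx⟩ := hπ.quotient.surjective (y : Sphere)
  simp only [Set.mem_compl_iff, Set.mem_preimage, Set.mem_union, not_or] at hy
  have h := hG.hasIndex hπ (fun h => hy.1 ⟨x, h, hx⟩) (fun h => hy.2 ⟨x, h, hx⟩) hx
    (by rw [← show G (π x) = π (A x) from congrFun hG x, hx]; exact hyfin) hyd
  exact (windsPositively_iff_hasIndex hcc.continuousAt hzw hd.self_of_nhds).2
    (h.unique (hA x))

end Orientation

/-! ### Postcritical set and orbifold -/

section PostcriticalSet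

variable {Λ : Submodule ℤ ℂ} [DiscreteTopology Λ] {π : ℂ → Sphere} {G : Sphere → Sphere}
  {A : ℂ ≃ᵃ[ℝ] ℂ}

theorem LiftsVia.hasLocalDegree_cases (hG : LiftsVia π G A) (hπ : IsHalfTurnQuotient Λ π)
    (hA : ∀ l ∈ Λ, A l ∈ Λ) (p : Sphere) :
    (p ∈ π '' (Λ : Set ℂ) ∧ G p ∈ π '' (Λ : Set ℂ) ∧ HasLocalDegree G p 1) ∨
    (p ∉ π '' (Λ : Set ℂ) ∧ HasLocalDegree G p 1) ∨
    (p ∉ π '' (Λ : Set ℂ) ∧ G p ∈ π '' (Λ : Set ℂ) ∧ HasLocalDegree G p 2) := by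
  obtain ⟨x, rfl⟩ := hπ.quotient.surjective p
  rw [show G (π x) = π (A x) from congrFun hG x, hπ.mem_image_iff, hπ.mem_image_iff]
  by_cases hx : x ∈ Λ
  · exact Or.inl ⟨hx, hA x hx, hG.hasLocalDegree_one_of_mem hπ hx (hA x hx)⟩
  by_cases hAx : A x ∈ Λ
  · exact Or.inr (Or.inr ⟨hx, hAx, hG.hasLocalDegree_two hπ hx hAx⟩)
  · exact Or.inr (Or.inl ⟨hx, hG.hasLocalDegree_one hπ hx hAx⟩)

theorem LiftsVia.apply_mem_of_mem_criticalSet (hG : LiftsVia π G A) (hπ : IsHalfTurnQuotient Λ π)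
    (hA : ∀ l ∈ Λ, A l ∈ Λ) {c : Sphere} (hc : c ∈ criticalSet G) :
    G c ∈ π '' (Λ : Set ℂ) := by
  obtain ⟨k, hk, hdeg⟩ := hc
  rcases hG.hasLocalDegree_cases hπ hA c with ⟨-, h, -⟩ | ⟨-, h⟩ | ⟨-, h, -⟩
  · exact h
  · have := h.unique hdeg
    omega
  · exact h

theorem apply_mem_postcriticalSet {G : Sphere → Sphere} {p : Sphere}
    (hp : p ∈ postcriticalSet G) : G p ∈ postcriticalSet G := by
  obtain ⟨n, hn, c, hc, rfl⟩ := hp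
  exact ⟨n + 1, by omega, c, hc, Function.iterate_succ_apply' G n c⟩

theorem postcriticalSet_induction {G : Sphere → Sphere} {s : Sphere → Prop}
    (hc : ∀ c ∈ criticalSet G, s (G c)) (hs : ∀ p, s p → s (G p)) {p : Sphere}
    (hp : p ∈ postcriticalSet G) : s p := by
  obtain ⟨n, hn, c, hcc, rfl⟩ := hp
  induction n, hn using Nat.le_induction with
  | base => exact hc c hcc
  | succ n _ ih => rw [Function.iterate_succ_apply']; exact hs _ ih

/-- Let `R` be the non-postcritical part of `π(Λ)`. A preimage of `R` outside `π(Λ)` would be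
critical, so `G⁻¹ R ⊆ R`; finiteness and surjectivity make `G` injective there. But `π x` and `π (x
+ 2v)` have equal images and are distinct for `x ∈ Λ`, so `R` is empty. -/
theorem LiftsVia.postcriticalSet_eq (hG : LiftsVia π G A) (hπ : IsHalfTurnQuotient Λ π)
    (hA : ∀ l ∈ Λ, A l ∈ Λ) (hfin : (π '' (Λ : Set ℂ)).Finite) {v : ℂ} (hv : v ∉ Λ)
    (hAv : A.linear v ∈ Λ) : postcriticalSet G = π '' (Λ : Set ℂ) := by
  have hGπ : ∀ x, G (π x) = π (A x) := congrFun hG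
  have hsub : postcriticalSet G ⊆ π '' (Λ : Set ℂ) := fun p hp => by
    refine postcriticalSet_induction (s := (· ∈ π '' (Λ : Set ℂ)))
      (fun c hc => hG.apply_mem_of_mem_criticalSet hπ hA hc) ?_ hp
    rintro _ ⟨x, hx, rfl⟩
    exact ⟨A x, hA x hx, (hGπ x).symm⟩
  refine hsub.antisymm ?_
  by_contra hnot
  obtain ⟨r, hr, hrP⟩ := Set.not_subset.1 hnot
  set R := π '' (Λ : Set ℂ) \ postcriticalSet G
  have hRfin : R.Finite := hfin.subset Set.sdiff_subset
  have hpre : G ⁻¹' R ⊆ R := fun p hp => by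
    refine ⟨?_, fun hpP => hp.2 (apply_mem_postcriticalSet hpP)⟩
    by_contra hpΛ
    obtain ⟨x, rfl⟩ := hπ.quotient.surjective p
    have hx : x ∉ Λ := fun hx => hpΛ ⟨x, hx, rfl⟩
    have hAx : A x ∈ Λ := hπ.mem_image_iff.1 (hGπ x ▸ hp.1)
    exact hp.2 ⟨1, le_rfl, π x, ⟨2, le_rfl, hG.hasLocalDegree_two hπ hx hAx⟩, rfl⟩
  have hsurj : Function.Surjective G := fun p => by
    obtain ⟨y, rfl⟩ := hπ.quotient.surjective p
    exact ⟨π (A.symm y), by rw [hGπ, A.apply_symm_apply]⟩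
  have himage : G '' (G ⁻¹' R) = R := Set.image_preimage_eq R hsurj
  have hpfin : (G ⁻¹' R).Finite := hRfin.subset hpre
  have hinj : Set.InjOn G (G ⁻¹' R) := by
    refine Set.injOn_of_ncard_image_eq (le_antisymm (Set.ncard_image_le hpfin) ?_) hpfin
    rw [himage]
    exact Set.ncard_le_ncard hpre hRfin
  obtain ⟨p, rfl⟩ := hsurj r
  have hp : p ∈ G ⁻¹' R := ⟨hr, hrP⟩
  obtain ⟨x, hx, rfl⟩ := (hpre hp).1
  have heq : G (π x) = G (π (x + 2 * v)) := by
    rw [hGπ, hGπ, hπ.fiber]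
    refine ⟨A.linear v, hAv, Or.inl ?_⟩
    rw [affineEquiv_apply_add, two_mul, map_add]
    ring
  have hmem : π (x + 2 * v) ∈ G ⁻¹' R := by
    rw [Set.mem_preimage, ← heq]; exact hp
  obtain ⟨l, hl, h | h⟩ := (hπ.fiber _ _).1 (hinj hp hmem heq)
  · exact hv ((show v = l by linear_combination h / 2) ▸ hl)
  · exact hv ((show v = l - x by linear_combination h / 2) ▸ sub_mem hl hx)

theorem LiftsVia.isEuclideanNETMap (hG : LiftsVia π G A) (hπ : IsHalfTurnQuotient Λ π)
    (hGc : Continuous G) (hA : ∀ l ∈ Λ, A l ∈ Λ) (hA1 : ∀ y, HasIndex A y 1)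
    (h4 : (π '' (Λ : Set ℂ)).ncard = 4) {v : ℂ} (hv : v ∉ Λ) (hAv : A.linear v ∈ Λ) :
    IsEuclideanNETMap G := by
  classical
  have hP := hG.postcriticalSet_eq hπ hA (Set.finite_of_ncard_pos (by omega)) hv hAv
  have hcases := hG.hasLocalDegree_cases hπ hA
  have hex : ∀ p, ∃ k, HasLocalDegree G p k := fun p => by
    rcases hcases p with ⟨-, -, h⟩ | ⟨-, h⟩ | ⟨-, -, h⟩ <;> exact ⟨_, h⟩
  refine ⟨⟨⟨⟨hGc, hex⟩, hG.preservesOrientation hπ hGc hA1⟩, fun p k hk => ?_, hP ▸ h4⟩,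
    fun p => if p ∈ π '' (Λ : Set ℂ) then 2 else 1, ⟨fun p k hk => ?_, fun μ hμ p => ?_⟩, ?_,
    fun p => ?_⟩
  · rcases hcases p with ⟨-, -, h⟩ | ⟨-, h⟩ | ⟨-, -, h⟩ <;> rw [hk.unique h]
    exact one_le_two
    exact one_le_two
  · rcases hcases p with ⟨h1, h2, h⟩ | ⟨h1, h⟩ | ⟨h1, h2, h⟩ <;> rw [hk.unique h]
    · simp only [if_pos h1, if_pos h2, mul_one, dvd_refl]
    · simp only [if_neg h1, mul_one, one_dvd]
    · simp only [if_neg h1, if_pos h2, one_mul, dvd_refl]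
  · dsimp only
    split_ifs with hp
    -- Minimality: any compatible weight is even at critical values, and evenness propagates along
    -- forward orbits.
    · refine postcriticalSet_induction (s := fun p => 2 ∣ μ p) ?_ ?_ (hP ▸ hp)
      · rintro c ⟨k, hk, hdeg⟩
        have hk2 : k = 2 := by
          rcases hcases c with ⟨-, -, h⟩ | ⟨-, h⟩ | ⟨-, -, h⟩ <;> have := hdeg.unique h <;> omega
        subst hk2
        exact (dvd_mul_left 2 _).trans (hμ c 2 hdeg)
      · intro q hq
        obtain ⟨k, hk⟩ := hex q
        exact hq.trans ((dvd_mul_right _ k).trans (hμ q k hk))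
    · exact one_dvd _
  · have : {p | (if p ∈ π '' (Λ : Set ℂ) then 2 else 1) = 2} = π '' (Λ : Set ℂ) := by
      ext p
      by_cases hp : p ∈ π '' (Λ : Set ℂ) <;> simp only [Set.mem_ofPred_eq, hp] <;> simp
    rw [this, h4]
  · dsimp only
    split_ifs
    · exact Or.inr rfl
    · exact Or.inl rfl

end PostcriticalSet

/-! ### Comparison of the two lattices -/

section Uniformization

variable {f : Sphere → Sphere} {Λ₁ Λ₂ : Submodule ℤ ℂ} {π₁ π₂ : ℂ → Sphere}

theorem IsUniformization.le (hπ : IsUniformization f Λ₁ Λ₂ π₁ π₂) : Λ₁ ≤ Λ₂ := by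
  intro l hl
  have h1 : π₁ 0 = π₁ (2 * l) := (hπ.quotient₁.fiber _ _).2 ⟨l, hl, Or.inl (by ring)⟩
  have h2 : π₂ 0 = π₂ (2 * l) := by
    rw [← hπ.comp, Function.comp_apply, Function.comp_apply, h1]
  obtain ⟨m, hm, h | h⟩ := (hπ.quotient₂.fiber _ _).1 h2
  all_goals exact (show l = m by linear_combination h / 2) ▸ hm

/-- Otherwise `π₁` and `π₂` have the same fibres, so `f` is injective and has no critical points. -/
theorem IsUniformization.exists_mem_notMem (hπ : IsUniformization f Λ₁ Λ₂ π₁ π₂)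
    (hf : IsNETMap f) : ∃ v ∈ Λ₂, v ∉ Λ₁ := by
  by_contra! hle
  have hinj : Function.Injective f := by
    intro p q hpq
    obtain ⟨x, rfl⟩ := hπ.quotient₁.quotient.surjective p
    obtain ⟨y, rfl⟩ := hπ.quotient₁.quotient.surjective q
    have h2 : π₂ x = π₂ y := by rw [← hπ.comp]; exact hpq
    obtain ⟨l, hl, h⟩ := (hπ.quotient₂.fiber _ _).1 h2
    exact (hπ.quotient₁.fiber _ _).2 ⟨l, hle l hl, h⟩
  have hempty : postcriticalSet f = ∅ := by
    refine Set.eq_empty_of_forall_notMem ?_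
    rintro _ ⟨n, -, c, ⟨k, hk, hdeg⟩, -⟩
    have := hdeg.le_one_of_injective hinj
    omega
  have h4 := hf.four
  rw [hempty, Set.ncard_empty] at h4
  omega

end Uniformization

end NETMap

/-! ### The main theorem -/

theorem theorem7p1
    (f : NETMap.Sphere → NETMap.Sphere) (hf : NETMap.IsNETMap f)
    (Λ₁ Λ₂ : Submodule ℤ ℂ)
    [DiscreteTopology Λ₁] [IsZLattice ℝ Λ₁] [DiscreteTopology Λ₂] [IsZLattice ℝ Λ₂]
    (π₁ π₂ : ℂ → NETMap.Sphere) (hπ : NETMap.IsUniformization f Λ₁ Λ₂ π₁ π₂)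
    (g : NETMap.Sphere → NETMap.Sphere) (hg : NETMap.IsEuclideanNETMap g)
    (h : NETMap.Sphere ≃ₜ NETMap.Sphere) (hfg : f = h ∘ g)
    (Φ : ℂ ≃ᵃ[ℝ] ℂ) (hΦ : Φ '' (Λ₂ : Set ℂ) = (Λ₁ : Set ℂ)) (hgΦ : NETMap.LiftsVia π₁ g Φ)
    (ψ : NETMap.Sphere → NETMap.Sphere) (hψ : NETMap.IsOrientedBranchedCovering ψ)
    (Ψ : ℂ ≃ᵃ[ℝ] ℂ) (hΨ : Ψ '' (Λ₂ : Set ℂ) ⊆ (Λ₂ : Set ℂ))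
    (hψΨ : NETMap.LiftsVia π₂ ψ Ψ) :
    ∃ g' : NETMap.Sphere → NETMap.Sphere,
      NETMap.IsEuclideanNETMap g' ∧
      NETMap.LiftsVia π₁ g' (Φ ∘ Ψ) ∧
      (∀ g'' : NETMap.Sphere → NETMap.Sphere, NETMap.LiftsVia π₁ g'' (Φ ∘ Ψ) → g'' = g') ∧
      ψ ∘ f = h ∘ g' := by
  have hπ₂ : ∀ x, π₂ x = h (π₁ (Φ x)) := fun x => by
    rw [← hπ.comp, Function.comp_apply, hfg, Function.comp_apply]
    exact congrArg h (congrFun hgΦ x)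
  have hlift : NETMap.LiftsVia π₁ (h.symm ∘ ψ ∘ f) (Φ ∘ Ψ) := by
    funext x
    have h1 : f (π₁ x) = π₂ x := congrFun hπ.comp x
    have h2 : ψ (π₂ x) = π₂ (Ψ x) := congrFun hψΨ x
    simp only [Function.comp_apply]
    rw [h1, h2, hπ₂, h.symm_apply_apply]
  have hΦmem : ∀ x ∈ Λ₂, Φ x ∈ Λ₁ := fun x hx => hΦ.subset ⟨x, hx, rfl⟩
  have hΨmem : ∀ x ∈ Λ₂, Ψ x ∈ Λ₂ := fun x hx => hΨ ⟨x, hx, rfl⟩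
  have hlin : ∀ (A : ℂ ≃ᵃ[ℝ] ℂ) (x : ℂ), A.linear x = A x - A 0 := fun A x => by
    have := NETMap.affineEquiv_apply_add A 0 x
    rw [zero_add] at this
    rw [this, add_sub_cancel_left]
  obtain ⟨v, hv₂, hv₁⟩ := hπ.exists_mem_notMem hf
  have hΦ1 := hgΦ.hasIndex_one_of_preservesOrientation hπ.quotient₁ hg.1.branched.1.1
    hg.1.branched.2
  have hΨ1 := hψΨ.hasIndex_one_of_preservesOrientation hπ.quotient₂ hψ.1.1 hψ.2
  have hΛ₁ : π₂ '' (Λ₂ : Set ℂ) = h '' (π₁ '' (Λ₁ : Set ℂ)) := by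
    rw [← hΦ, Set.image_image, Set.image_image]
    exact Set.image_congr fun x _ => hπ₂ x
  refine ⟨h.symm ∘ ψ ∘ f, ?_, hlift, fun g'' hg'' => ?_, ?_⟩
  · refine NETMap.LiftsVia.isEuclideanNETMap (A := Ψ.trans Φ) hlift hπ.quotient₁
      (h.symm.continuous.comp (hψ.1.1.comp hf.branched.1.1))
      (fun l hl => hΦmem _ (hΨmem l (hπ.le hl)))
      (fun y => (hΦ1 (Ψ y)).comp (hΨ1 y) (NETMap.continuous_affineEquiv Ψ).continuousAt) ?_ hv₁ ?_
    -- `h` carries `π₁(Λ₁)` bijectively onto `π₂(Λ₂)`, the four-point postcritical set of `f`.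
    · rw [← Set.ncard_image_of_injective _ h.injective, ← hΛ₁, hπ.image₂, hf.four]
    · rw [hlin]
      -- The linear part at `v` is a difference of two values of `Φ ∘ Ψ` on `Λ₂`, and these lie in
      -- `Λ₁`.
      exact sub_mem (hΦmem _ (hΨmem v hv₂)) (hΦmem _ (hΨmem 0 (zero_mem Λ₂)))
  · refine hπ.quotient₁.quotient.surjective.injective_comp_right ?_
    exact (show g'' ∘ π₁ = _ from hg'').trans hlift.symm
  · funext x
    simp only [Function.comp_apply, h.apply_symm_apply]
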